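/- Let $V$ be a finite-dimensional complex vector space and let $M=(m_{ij})_{0\le i,j\le 5}$ be a skew-symmetric $6\times 6$ matrix with entries in $V^*$. For a $6\times 6$ pattern $F$ with entries $0$ and $*$ (a blank stands for $0$), a matrix $N$ with entries in $V^*$ has *form* $F$ if $n_{ij}=0$ whenever $F_{ij}=0$ (no condition is imposed where $F_{ij}=*$). We say that $M$ has *skew format* $F$ if there is $S\in\mathrm{GL}_6(\mathbb C)$ such that $SMS^t$ has form $F$, and *double skew format* $F$ if there is $S\in\mathrm{GL}_6(\mathbb C)$ such that $SMS^t$ has form $F$ and moreover $$SMS^t=\begin{pmatrix} N_0&N_1\\-N_1^t&N_2\end{pmatrix}$$ with skew-symmetric $3\times3$ matrices $N_0,N_1,N_2$ with entries in $V^*$. **Proposition.** Suppose that $M$ has the skew format (the "arrow format") $$\begin{pmatrix}0&*&*&*&*&*\\ *&0&*&*&*&*\\ *&*&0&*&*&0\\ *&*&*&0&*&0\\ *&*&*&*&0&0\\ *&*&0&0&0&0\end{pmatrix}$$ and that its Pfaffian $\mathrm{Pf}(M)\in\mathrm{Sym}(V^*)$ vanishes. Then $M$ has at least one of the skew formats $$(a)\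 \begin{pmatrix}0&*&*&*&*&\\ *&0&*&*&*&\\ *&*&0&*&*&\\ *&*&*&0&*&\\ *&*&*&*&0&\\ &&&&&\end{pmatrix}\quad (b)\ \begin{pmatrix}&*&*&*&*&*\\ *&&*&*&*&*\\ *&*&&&&\\ *&*&&&&\\ *&*&&&&\\ *&*&&&&\end{pmatrix}\quad (c)\ \begin{pmatrix}0&*&*&*&*&*\\ *&0&*&*&&\\ *&*&0&*&&\\ *&*&*&0&&\\ *&&&&&\\ *&&&&&\end{pmatrix}$$ or at least one of the double skew formats $$(d)\ \begin{pmatrix}0&*&*&&&\\ *&0&*&&&\\ *&*&0&&&\\ &&&0&*&*\\ &&&*&0&*\\ &&&*&*&0\end{pmatrix}\quad (e)\ \begin{pmatrix}0&*&*&0&*&*\\ *&0&*&*&0&*\\ *&*&0&*&*&0\\ 0&*&*&&&\\ *&0&*&&&\\ *&*&0&&&\end{pmatrix}\quad (f)\ \begin{pmatrix}&*&&0&*&*\\ *&&&*&0&*\\ &&&*&*&0\\ 0&*&*&&*&\\ *&0&*&*&&\\ *&*&0&&&\end{pmatrix}$$ -/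

import Mathlib

/-- The Pfaffian of a skew-symmetric `n × n` matrix, by Laplace expansion along the first row.
Deleting the rows and columns with indices `0` and `j + 1` leaves the indices
`(j.succAbove k).succ`; the sign at `j + 1` is `(-1) ^ (0 + (j + 1) + 1) = (-1) ^ j`.
For odd `n` the value is `0`. -/
def Matrix.pfaffian {R : Type*} [CommRing R] : (n : ℕ) → Matrix (Fin n) (Fin n) R → R
  | 0, _ => 1
  | 1, _ => 0
  | n + 2, M => ∑ j : Fin (n + 1), (-1) ^ (j : ℕ) * M 0 j.succ *
      Matrix.pfaffian n
        (M.submatrix (fun k => (j.succAbove k).succ) (fun k => (j.succAbove k).succ))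

namespace LinForms

/-- An `r × s` matrix of linear forms over `ℙ(V)`: a matrix with entries in the dual of `V`. -/
abbrev LinMatrix (V : Type*) [AddCommGroup V] [Module ℂ V] (r s : ℕ) :=
  Matrix (Fin r) (Fin s) (Module.Dual ℂ V)

/-- A pattern: the entry `0` stands for a prescribed zero, the entry `1` for a `*`. -/
abbrev Pattern (r s : ℕ) := Matrix (Fin r) (Fin s) (Fin 2)

variable {V : Type*} [AddCommGroup V] [Module ℂ V] {r s : ℕ}

/-- `M` is skew-symmetric. -/
def IsSkew (M : LinMatrix V r r) : Prop := M.transpose = -M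

/-- `M` has form `F`: `M` vanishes wherever `F` has a `0`. -/
def HasForm (M : LinMatrix V r s) (F : Pattern r s) : Prop :=
  ∀ i j, F i j = 0 → M i j = 0

/-- The matrix product `S M Sᵗ`, for a complex matrix `S` and a matrix `M` of linear forms. -/
noncomputable def congrBy (S : Matrix (Fin r) (Fin r) ℂ) (M : LinMatrix V r r) :
    LinMatrix V r r :=
  Matrix.of fun i j => ∑ k, ∑ l, (S i k * S j l) • M k l

/-- The skew matrix `M` has skew format `F`: some `S M Sᵗ` with `S ∈ GL_r(ℂ)` has form `F`. -/
def HasSkewFormat (M : LinMatrix V r r) (F : Pattern r r) : Prop :=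
  ∃ S : Matrix.GeneralLinearGroup (Fin r) ℂ, HasForm (congrBy S.val M) F

/-- `M` is double skew: it consists of four blocks `N₀, N₁, -N₁ᵗ, N₂`
with `N₀`, `N₁`, `N₂` skew-symmetric `3 × 3` matrices of linear forms. -/
def IsDoubleSkew (M : LinMatrix V 6 6) : Prop :=
  ∃ N₀ N₁ N₂ : LinMatrix V 3 3, IsSkew N₀ ∧ IsSkew N₁ ∧ IsSkew N₂ ∧
    M = (Matrix.fromBlocks N₀ N₁ (-N₁.transpose) N₂).submatrix
      (finSumFinEquiv (m := 3) (n := 3)).symm (finSumFinEquiv (m := 3) (n := 3)).symm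

/-- `M` has double skew format `F`: some `S M Sᵗ` with `S ∈ GL_6(ℂ)` is double skew
and has form `F`. -/
def HasDoubleSkewFormat (M : LinMatrix V 6 6) (F : Pattern 6 6) : Prop :=
  ∃ S : Matrix.GeneralLinearGroup (Fin 6) ℂ,
    IsDoubleSkew (congrBy S.val M) ∧ HasForm (congrBy S.val M) F

/-- The Pfaffian of a matrix of linear forms, an element of the polynomial ring `Sym(V*)`. -/
noncomputable def pf (M : LinMatrix V r r) : SymmetricAlgebra ℂ (Module.Dual ℂ V) :=
  Matrix.pfaffian r (M.map (SymmetricAlgebra.ι ℂ (Module.Dual ℂ V)))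

/-- The arrow pattern. -/
def arrowPattern : Pattern 6 6 :=
  !![0, 1, 1, 1, 1, 1;
     1, 0, 1, 1, 1, 1;
     1, 1, 0, 1, 1, 0;
     1, 1, 1, 0, 1, 0;
     1, 1, 1, 1, 0, 0;
     1, 1, 0, 0, 0, 0]

/-- Pattern (a). -/
def patternA : Pattern 6 6 :=
  !![0, 1, 1, 1, 1, 0;
     1, 0, 1, 1, 1, 0;
     1, 1, 0, 1, 1, 0;
     1, 1, 1, 0, 1, 0;
     1, 1, 1, 1, 0, 0;
     0, 0, 0, 0, 0, 0]

/-- Pattern (b). -/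
def patternB : Pattern 6 6 :=
  !![0, 1, 1, 1, 1, 1;
     1, 0, 1, 1, 1, 1;
     1, 1, 0, 0, 0, 0;
     1, 1, 0, 0, 0, 0;
     1, 1, 0, 0, 0, 0;
     1, 1, 0, 0, 0, 0]

/-- Pattern (c). -/
def patternC : Pattern 6 6 :=
  !![0, 1, 1, 1, 1, 1;
     1, 0, 1, 1, 0, 0;
     1, 1, 0, 1, 0, 0;
     1, 1, 1, 0, 0, 0;
     1, 0, 0, 0, 0, 0;
     1, 0, 0, 0, 0, 0]

/-- Pattern (d). -/
def patternD : Pattern 6 6 :=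
  !![0, 1, 1, 0, 0, 0;
     1, 0, 1, 0, 0, 0;
     1, 1, 0, 0, 0, 0;
     0, 0, 0, 0, 1, 1;
     0, 0, 0, 1, 0, 1;
     0, 0, 0, 1, 1, 0]

/-- Pattern (e). -/
def patternE : Pattern 6 6 :=
  !![0, 1, 1, 0, 1, 1;
     1, 0, 1, 1, 0, 1;
     1, 1, 0, 1, 1, 0;
     0, 1, 1, 0, 0, 0;
     1, 0, 1, 0, 0, 0;
     1, 1, 0, 0, 0, 0]

/-- Pattern (f). -/
def patternF : Pattern 6 6 :=
  !![0, 1, 0, 0, 1, 1;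
     1, 0, 0, 1, 0, 1;
     0, 0, 0, 1, 1, 0;
     0, 1, 1, 0, 1, 0;
     1, 0, 1, 1, 0, 0;
     1, 1, 0, 0, 0, 0]

end LinForms

namespace LinForms

/-! In arrow form the matrix is given by w, x, y and triples u, v, p of linear forms: the middle
block is the cross-product matrix of p, and Pf = x(v·p) − y(u·p). Everything follows from x(v·p) =
y(u·p), read as an identity of functions on V.

If x, y are independent, coprimality (`exists_common_factor`) gives u·p = xl and v·p = yl. When l =
e·p, adding multiples of the last row to the middle rows makes u and v syzygies of p. Linear
syzygies of independent forms are Koszul (`koszul_syzygy`), hence removable by adding middle rows to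
the first two, and the rank 0, 1, 2, 3 of p gives (b), (a), (c), (d). When l is outside the span of
p, that span generates a prime ideal containing xl and yl, so it contains x and y; normalizing p to
(x, y, z) gives (e) if z = 0 and (f) if x, y, z are independent.

If x, y are dependent, one may take y = 0; then x = 0, which is (a), or v·p = 0, and the same syzygy
argument gives (b) or (c). -/

/-! ### Pfaffians of 6 × 6 matrices under congruence -/

/-- Pfaffians commute with ring homomorphisms. -/
theorem map_pfaffian {R R' : Type*} [CommRing R] [CommRing R'] (f : R →+* R') :
    ∀ (n : ℕ) (M : Matrix (Fin n) (Fin n) R),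
      f (Matrix.pfaffian n M) = Matrix.pfaffian n (M.map f)
  | 0, _ => by simp [Matrix.pfaffian]
  | 1, _ => by simp [Matrix.pfaffian]
  | n + 2, M => by
    simp only [Matrix.pfaffian, map_sum, map_mul, map_pow, map_neg, map_one,
      map_pfaffian f n, Matrix.map_apply]
    rfl

theorem pfaffian_six {R : Type*} [CommRing R] (M : Matrix (Fin 6) (Fin 6) R) :
    Matrix.pfaffian 6 M =
      M 0 1 * (M 2 3 * M 4 5 - M 2 4 * M 3 5 + M 2 5 * M 3 4)
      - M 0 2 * (M 1 3 * M 4 5 - M 1 4 * M 3 5 + M 1 5 * M 3 4)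
      + M 0 3 * (M 1 2 * M 4 5 - M 1 4 * M 2 5 + M 1 5 * M 2 4)
      - M 0 4 * (M 1 2 * M 3 5 - M 1 3 * M 2 5 + M 1 5 * M 2 3)
      + M 0 5 * (M 1 2 * M 3 4 - M 1 3 * M 2 4 + M 1 4 * M 2 3) := by
  have e {n : ℕ} (j : Fin (n + 1)) (k : Fin n) :
      j.succAbove k = if (k : ℕ) < j then k.castSucc else k.succ := rfl
  simp only [Matrix.pfaffian, Fin.sum_univ_succ, e, Matrix.submatrix_apply]
  simp [Fin.succ, Fin.castSucc, Fin.castAdd, Fin.castLE]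
  ring

variable {V : Type*} [AddCommGroup V] [Module ℂ V]

theorem skew_entries {R : Type*} [AddCommGroup R] {n : ℕ} {N : Matrix (Fin n) (Fin n) R}
    (hN : N.transpose = -N) (i j : Fin n) : N j i = -N i j := by
  simpa using congrFun (congrFun hN i) j

theorem skew_diag {R : Type*} [AddCommGroup R] [Module ℂ R] {n : ℕ}
    {N : Matrix (Fin n) (Fin n) R} (hN : N.transpose = -N) (i : Fin n) : N i i = 0 := by
  have h : (2 : ℂ) • N i i = 0 := by
    rw [two_smul]
    nth_rewrite 1 [skew_entries hN i i]
    exact neg_add_cancel _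
  exact (smul_eq_zero.1 h).resolve_left two_ne_zero

/-- The skew-symmetric matrix with prescribed entries above the diagonal. -/
def skewSix {R : Type*} [AddCommGroup R] (a b c d e f g h i j k l m n o : R) :
    Matrix (Fin 6) (Fin 6) R :=
  !![0, a, b, c, d, e; -a, 0, f, g, h, i; -b, -f, 0, j, k, l; -c, -g, -j, 0, m, n;
    -d, -h, -k, -m, 0, o; -e, -i, -l, -n, -o, 0]

theorem eq_skewSix {R : Type*} [AddCommGroup R] [Module ℂ R] {N : Matrix (Fin 6) (Fin 6) R}
    (hN : N.transpose = -N) :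
    N = skewSix (N 0 1) (N 0 2) (N 0 3) (N 0 4) (N 0 5) (N 1 2) (N 1 3) (N 1 4) (N 1 5)
      (N 2 3) (N 2 4) (N 2 5) (N 3 4) (N 3 5) (N 4 5) := by
  ext i j
  fin_cases i <;> fin_cases j <;> simp [skewSix, skew_diag hN] <;> exact skew_entries hN _ _

theorem pfaffian_transvection {N : Matrix (Fin 6) (Fin 6) ℂ} (hN : N.transpose = -N)
    (i j : Fin 6) (hij : i ≠ j) (c : ℂ) :
    Matrix.pfaffian 6 (Matrix.transvection i j c * N * (Matrix.transvection i j c).transpose) =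
      Matrix.pfaffian 6 N := by
  have key (k l : Fin 6) :
      (Matrix.transvection i j c * N * (Matrix.transvection i j c).transpose) k l =
        N k l + (if i = k then c * N j l else 0) + (if i = l then c * N k j else 0) := by
    have h0 : N j j = 0 := skew_diag hN j
    simp only [Matrix.mul_apply, Matrix.transpose_apply, Matrix.transvection, Matrix.add_apply,
      Matrix.one_apply, Matrix.single_apply, add_mul, mul_add, Finset.sum_add_distrib, ite_and]
    by_cases h1 : i = k <;> by_cases h2 : i = l <;> simp [h1, h2, h0] <;> ring_nf
  rw [pfaffian_six, pfaffian_six]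
  simp only [key]
  rw [eq_skewSix hN]
  generalize N 0 1 = a01, N 0 2 = a02, N 0 3 = a03, N 0 4 = a04, N 0 5 = a05, N 1 2 = a12,
    N 1 3 = a13, N 1 4 = a14, N 1 5 = a15, N 2 3 = a23, N 2 4 = a24, N 2 5 = a25, N 3 4 = a34,
    N 3 5 = a35, N 4 5 = a45
  fin_cases i <;> fin_cases j <;> first | exact absurd rfl hij | (simp [skewSix]; try ring)

theorem pfaffian_diagonal (N : Matrix (Fin 6) (Fin 6) ℂ) (D : Fin 6 → ℂ) :
    Matrix.pfaffian 6 (Matrix.diagonal D * N * (Matrix.diagonal D).transpose) =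
      (∏ i, D i) * Matrix.pfaffian 6 N := by
  rw [pfaffian_six, pfaffian_six]
  simp only [Matrix.diagonal_transpose, Matrix.mul_diagonal, Matrix.diagonal_mul,
    Fin.prod_univ_six]
  ring

/-- Transvections and diagonal matrices generate the invertible ones. Tracking only vanishing avoids
the determinant formula for Pfaffians. -/
theorem pfaffian_congr_eq_zero (S : Matrix (Fin 6) (Fin 6) ℂ) (hS : S.det ≠ 0) :
    ∀ N : Matrix (Fin 6) (Fin 6) ℂ, N.transpose = -N → Matrix.pfaffian 6 N = 0 →
      Matrix.pfaffian 6 (S * N * S.transpose) = 0 := by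
  refine Matrix.diagonal_transvection_induction_of_det_ne_zero
    (fun S : Matrix (Fin 6) (Fin 6) ℂ => ∀ N : Matrix (Fin 6) (Fin 6) ℂ, N.transpose = -N →
      Matrix.pfaffian 6 N = 0 → Matrix.pfaffian 6 (S * N * S.transpose) = 0) S hS ?_ ?_ ?_
  · intro D _ N _ h
    rw [pfaffian_diagonal, h, mul_zero]
  · intro t N hN h
    rw [Matrix.TransvectionStruct.toMatrix, pfaffian_transvection hN _ _ t.hij, h]
  · intro A B _ _ hA hB N hN h
    have := hA _ (by simp [Matrix.transpose_mul, hN, Matrix.mul_assoc]) (hB N hN h)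
    simpa [Matrix.transpose_mul, Matrix.mul_assoc] using this

/-! ### Syzygies and divisibility for linear and quadratic forms -/

/-- Linearly independent linear forms have dual vectors. -/
theorem exists_dual_vectors [FiniteDimensional ℂ V] {n : ℕ} {p : Fin n → Module.Dual ℂ V}
    (hp : LinearIndependent ℂ p) : ∃ e : Fin n → V, ∀ i j, p i (e j) = if i = j then 1 else 0 := by
  -- The coordinate functionals on the span of `p` extend to the whole dual; by reflexivity they are
  -- evaluations at vectors.
  choose g hg using fun j : Fin n =>
    LinearMap.exists_extend ((Finsupp.lapply j : (Fin n →₀ ℂ) →ₗ[ℂ] ℂ) ∘ₗ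
      (hp.repr : Submodule.span ℂ (Set.range p) →ₗ[ℂ] (Fin n →₀ ℂ)))
  refine ⟨fun j => (Module.evalEquiv ℂ V).symm (g j), fun i j => ?_⟩
  have h := LinearMap.congr_fun (hg j) ⟨p i, Submodule.subset_span ⟨i, rfl⟩⟩
  have h2 : hp.repr ⟨p i, Submodule.subset_span ⟨i, rfl⟩⟩ = Finsupp.single i 1 :=
    hp.repr_eq_single i _ rfl
  simp only [LinearMap.comp_apply, h2, Submodule.subtype_apply,
    Finsupp.lapply_apply, Finsupp.single_apply] at h
  simpa [Module.apply_evalEquiv_symm_apply] using h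

/-- Linear syzygies of linearly independent linear forms are the Koszul syzygies. -/
theorem koszul_syzygy [FiniteDimensional ℂ V] {n : ℕ} {p v : Fin n → Module.Dual ℂ V}
    (hp : LinearIndependent ℂ p) (h : ∀ w, ∑ i, v i w * p i w = 0) :
    ∃ A : Fin n → Fin n → ℂ, (∀ i j, A i j = -A j i) ∧ ∀ i, v i = ∑ j, A i j • p j := by
  obtain ⟨e, he⟩ := exists_dual_vectors hp
  have h2 (w w' : V) : ∑ i, v i w * p i w' + ∑ i, v i w' * p i w = 0 := by
    have h3 := h (w + w')
    simp only [map_add, add_mul, mul_add, Finset.sum_add_distrib, h, zero_add, add_zero] at h3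
    rw [← h3, add_comm]
  -- Polarizing at (e i, e j) gives antisymmetry; polarizing at (w, e i) gives the formula for `v
  -- i`.
  refine ⟨fun i j => -v j (e i), fun i j => ?_, fun i => ?_⟩
  · have := h2 (e i) (e j)
    simp only [he, mul_ite, mul_one, mul_zero, Finset.sum_ite_eq', Finset.mem_univ, if_true] at this
    linear_combination -this
  · ext w
    have := h2 w (e i)
    simp only [he, mul_ite, mul_one, mul_zero, Finset.sum_ite_eq', Finset.mem_univ, if_true] at this
    simp only [LinearMap.sum_apply, LinearMap.smul_apply, smul_eq_mul, neg_mul,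
      Finset.sum_neg_distrib]
    linear_combination this

/-- A quadratic form vanishing on a hyperplane is divisible by its equation. -/
theorem exists_factor_of_vanish (B : V →ₗ[ℂ] V →ₗ[ℂ] ℂ) {y : Module.Dual ℂ V} (hy : y ≠ 0)
    (h : ∀ w, y w = 0 → B w w = 0) : ∃ l : Module.Dual ℂ V, ∀ w, B w w = y w * l w := by
  obtain ⟨e, he⟩ : ∃ e, y e = 1 := by
    obtain ⟨e, he⟩ := DFunLike.ne_iff.1 hy
    exact ⟨(y e)⁻¹ • e, by simpa using inv_mul_cancel₀ he⟩
  -- Expand the vanishing of B at w − y(w)e, the projection of w to the hyperplane along e.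
  refine ⟨B e + B.flip e - B e e • y, fun w => ?_⟩
  have := h (w - y w • e) (by simp [he])
  simp only [map_sub, map_smul, LinearMap.sub_apply, LinearMap.smul_apply, smul_eq_mul] at this
  simp only [LinearMap.sub_apply, LinearMap.add_apply, LinearMap.flip_apply,
    LinearMap.smul_apply, smul_eq_mul]
  linear_combination this

/-- Cancelling a linear form from the restriction of a quadratic form to a subspace. -/
theorem vanish_of_mul_vanish (B : V →ₗ[ℂ] V →ₗ[ℂ] ℂ) {x y : Module.Dual ℂ V} {e : V}
    (hx : x e ≠ 0) (hy : y e = 0) (h : ∀ w, y w = 0 → x w * B w w = 0) :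
    ∀ w, y w = 0 → B w w = 0 := by
  intro w hw
  by_cases hxw : x w = 0
  -- Where x(w) = 0, x is nonzero at e and w ± e; the parallelogram identity recovers B(w, w).
  · have h0 := (mul_eq_zero.1 (h e hy)).resolve_left hx
    have h1 := (mul_eq_zero.1 (h (w + e) (by simp [hw, hy]))).resolve_left (by simpa [hxw] using hx)
    have h2 := (mul_eq_zero.1 (h (w - e) (by simp [hw, hy]))).resolve_left (by simpa [hxw] using hx)
    simp only [map_add, map_sub, LinearMap.add_apply, LinearMap.sub_apply] at h1 h2
    linear_combination (h1 + h2) / 2 - h0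
  · exact (mul_eq_zero.1 (h w hw)).resolve_left hxw

theorem mul_vanish {x : Module.Dual ℂ V} (hx : x ≠ 0) (B : V →ₗ[ℂ] V →ₗ[ℂ] ℂ)
    (h : ∀ w, x w * B w w = 0) (w : V) : B w w = 0 := by
  obtain ⟨e, he⟩ := DFunLike.ne_iff.1 hx
  exact vanish_of_mul_vanish (y := 0) B he rfl (fun w _ => h w) w rfl

/-- Coprime factors of an identity `x q₁ = y q₂` of cubic forms. -/
theorem exists_common_factor [FiniteDimensional ℂ V] (B₁ B₂ : V →ₗ[ℂ] V →ₗ[ℂ] ℂ)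
    {x y : Module.Dual ℂ V}
    (hxy : LinearIndependent ℂ ![x, y]) (h : ∀ w, x w * B₁ w w = y w * B₂ w w) :
    ∃ l : Module.Dual ℂ V, ∀ w, B₁ w w = y w * l w ∧ B₂ w w = x w * l w := by
  have hy : y ≠ 0 := hxy.ne_zero 1
  obtain ⟨e, he⟩ := exists_dual_vectors hxy
  obtain ⟨l, hl⟩ := exists_factor_of_vanish B₁ hy
    (vanish_of_mul_vanish B₁ (x := x) (e := e 0) (by simpa using (he 0 0).trans_ne one_ne_zero)
      (by simpa using he 1 0) (fun w hw => by rw [h, hw, zero_mul]))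
  have h2 := mul_vanish hy (B₂ - (LinearMap.mul ℂ ℂ).compl₁₂ x l) (fun w => by
    simp only [LinearMap.sub_apply, LinearMap.compl₁₂_apply, LinearMap.mul_apply']
    linear_combination -h w + x w * hl w)
  refine ⟨l, fun w => ⟨hl w, ?_⟩⟩
  simpa [sub_eq_zero] using h2 w

/-- The bilinear form `∑ vᵢ ⊗ pᵢ`. -/
noncomputable def tensorSum {n : ℕ} (v p : Fin n → Module.Dual ℂ V) : V →ₗ[ℂ] V →ₗ[ℂ] ℂ :=
  ∑ i, (LinearMap.mul ℂ ℂ).compl₁₂ (v i) (p i)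

theorem tensorSum_apply {n : ℕ} (v p : Fin n → Module.Dual ℂ V) (w w' : V) :
    tensorSum v p w w' = ∑ i, v i w * p i w' := by
  simp [tensorSum]

/-! ### Normal forms for triples and cofactor matrices -/

/-- The linear combinations of a family given by the rows of a matrix. -/
def rowComb {n : ℕ} {E : Type*} [AddCommGroup E] [Module ℂ E] (Q : Matrix (Fin n) (Fin n) ℂ)
    (p : Fin n → E) : Fin n → E :=
  fun i => ∑ j, Q i j • p j

theorem rowComb_one {n : ℕ} {E : Type*} [AddCommGroup E] [Module ℂ E] (p : Fin n → E) :
    rowComb 1 p = p := by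
  ext i
  simp [rowComb, Matrix.one_apply]

theorem rowComb_mul {n : ℕ} {E : Type*} [AddCommGroup E] [Module ℂ E]
    (Q R : Matrix (Fin n) (Fin n) ℂ) (p : Fin n → E) :
    rowComb (Q * R) p = rowComb Q (rowComb R p) := by
  ext i
  simp only [rowComb, Matrix.mul_apply, Finset.sum_smul, Finset.smul_sum, smul_smul]
  exact Finset.sum_comm

/-- A triple consisting of linearly independent vectors followed by zeros. -/
def IsReduced {E : Type*} [AddCommGroup E] [Module ℂ E] (p : Fin 3 → E) : Prop :=
  p = ![0, 0, 0] ∨ (∃ a, a ≠ 0 ∧ p = ![a, 0, 0]) ∨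
    (∃ a b, LinearIndependent ℂ ![a, b] ∧ p = ![a, b, 0]) ∨ LinearIndependent ℂ p

theorem exists_isReduced_rowComb {E : Type*} [AddCommGroup E] [Module ℂ E] (p : Fin 3 → E) :
    ∃ Q : Matrix (Fin 3) (Fin 3) ℂ, Q.det ≠ 0 ∧ IsReduced (rowComb Q p) := by
  by_cases hp : LinearIndependent ℂ p
  · exact ⟨1, by simp, by rw [rowComb_one]; exact .inr (.inr (.inr hp))⟩
  have h1 : ∃ Q : Matrix (Fin 3) (Fin 3) ℂ, Q.det ≠ 0 ∧ rowComb Q p 2 = 0 := by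
    obtain ⟨g, hg, i, hi⟩ := Fintype.not_linearIndependent_iff.1 hp
    fin_cases i
    -- The relation becomes the last row; the determinant is its nonzero coefficient up to sign.
    · exact ⟨!![0, 1, 0; 0, 0, 1; g 0, g 1, g 2], by simpa [Matrix.det_fin_three] using hi,
        by simpa [rowComb, Fin.sum_univ_three] using hg⟩
    · exact ⟨!![1, 0, 0; 0, 0, 1; g 0, g 1, g 2], by simpa [Matrix.det_fin_three] using hi,
        by simpa [rowComb, Fin.sum_univ_three] using hg⟩
    · exact ⟨!![1, 0, 0; 0, 1, 0; g 0, g 1, g 2], by simpa [Matrix.det_fin_three] using hi,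
        by simpa [rowComb, Fin.sum_univ_three] using hg⟩
  obtain ⟨Q, hQ, hp2⟩ := h1
  have hQp : rowComb Q p = ![rowComb Q p 0, rowComb Q p 1, 0] := by
    ext i; fin_cases i <;> simp [hp2]
  by_cases hab : LinearIndependent ℂ ![rowComb Q p 0, rowComb Q p 1]
  · exact ⟨Q, hQ, .inr (.inr (.inl ⟨_, _, hab, hQp⟩))⟩
  have h2 : ∃ R : Matrix (Fin 3) (Fin 3) ℂ, R.det ≠ 0 ∧ ∃ a, rowComb R (rowComb Q p) = ![a, 0, 0] := by
    obtain ⟨g, hg, i, hi⟩ := Fintype.not_linearIndependent_iff.1 hab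
    rw [hQp]
    simp only [Fin.sum_univ_two, Matrix.cons_val_zero, Matrix.cons_val_one] at hg
    fin_cases i
    · refine ⟨!![0, 1, 0; g 0, g 1, 0; 0, 0, 1], by simpa [Matrix.det_fin_three] using hi,
        rowComb Q p 1, ?_⟩
      ext i; fin_cases i <;> simp [rowComb, Fin.sum_univ_three] 
      simpa [rowComb, Fin.sum_univ_three] using hg
    · refine ⟨!![1, 0, 0; g 0, g 1, 0; 0, 0, 1], by simpa [Matrix.det_fin_three] using hi,
        rowComb Q p 0, ?_⟩
      ext i; fin_cases i <;> simp [rowComb, Fin.sum_univ_three] 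
      simpa [rowComb, Fin.sum_univ_three] using hg
  obtain ⟨R, hR, a, ha⟩ := h2
  refine ⟨R * Q, by rw [Matrix.det_mul]; exact mul_ne_zero hR hQ, ?_⟩
  rw [rowComb_mul, ha]
  by_cases h0 : a = 0
  · exact .inl (by rw [h0])
  · exact .inr (.inl ⟨a, h0, rfl⟩)

/-- Coefficient vectors of x and y are independent, so they extend to a basis. If the resulting
third vector depends on x and y, subtracting that dependence makes it zero. -/
theorem exists_rowComb_eq {E : Type*} [AddCommGroup E] [Module ℂ E] {p : Fin 3 → E} {x y : E}
    (hxy : LinearIndependent ℂ ![x, y]) (hx : x ∈ Submodule.span ℂ (Set.range p))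
    (hy : y ∈ Submodule.span ℂ (Set.range p)) :
    ∃ Q : Matrix (Fin 3) (Fin 3) ℂ, Q.det ≠ 0 ∧ ∃ z, rowComb Q p = ![x, y, z] ∧
      (z = 0 ∨ LinearIndependent ℂ ![x, y, z]) := by
  obtain ⟨a, ha⟩ := (Submodule.mem_span_range_iff_exists_fun ℂ).1 hx
  obtain ⟨b, hb⟩ := (Submodule.mem_span_range_iff_exists_fun ℂ).1 hy
  have hab : LinearIndependent ℂ ![a, b] := by
    rw [LinearIndependent.pair_iff] at hxy ⊢
    intro s t hst
    refine hxy s t ?_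
    have : ∑ i, (s • a + t • b) i • p i = 0 := by
      rw [hst]; simp
    simpa [add_smul, Finset.sum_add_distrib, mul_smul, ← Finset.smul_sum, ha, hb] using this
  obtain ⟨c, hc⟩ := exists_linearIndependent_snoc_of_lt_finrank hab (by simp)
  have hQ : (Matrix.of ![a, b, c]).det ≠ 0 := by
    have h3 : LinearIndependent ℂ (Matrix.of ![a, b, c]).row := by
      have h4 : (Matrix.of ![a, b, c]).row = Fin.snoc ![a, b] c := by
        ext i j; fin_cases i <;> rfl
      rw [h4]
      exact hc
    exact ((Matrix.isUnit_iff_isUnit_det _).1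
      (Matrix.linearIndependent_rows_iff_isUnit.1 h3)).ne_zero
  set z := ∑ i, c i • p i with hz
  have hQp : rowComb (Matrix.of ![a, b, c]) p = ![x, y, z] := by
    ext i; fin_cases i <;> simp [rowComb, ha, hb, hz]
  by_cases hl : LinearIndependent ℂ ![x, y, z]
  · exact ⟨_, hQ, z, hQp, .inr hl⟩
  obtain ⟨g, hg, i, hi⟩ := Fintype.not_linearIndependent_iff.1 hl
  simp only [Fin.sum_univ_three, Matrix.cons_val] at hg
  have hg2 : g 2 ≠ 0 := by
    intro h0
    rw [h0, zero_smul, add_zero] at hg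
    obtain ⟨h1, h2⟩ := LinearIndependent.pair_iff.1 hxy _ _ hg
    fin_cases i
    exacts [hi h1, hi h2, hi h0]
  refine ⟨!![1, 0, 0; 0, 1, 0; g 0, g 1, g 2] * Matrix.of ![a, b, c], ?_, 0, ?_, .inl rfl⟩
  · rw [Matrix.det_mul]
    exact mul_ne_zero (by simpa [Matrix.det_fin_three] using hg2) hQ
  · rw [rowComb_mul, hQp]
    ext i; fin_cases i <;> simp [rowComb, Fin.sum_univ_three]
    exact hg

/-- Every invertible `3 × 3` matrix is the cofactor matrix of an invertible matrix. -/
theorem exists_cofactor_eq (Q : Matrix (Fin 3) (Fin 3) ℂ) (hQ : Q.det ≠ 0) :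
    ∃ T : Matrix (Fin 3) (Fin 3) ℂ, T.det ≠ 0 ∧ T.adjugate.transpose = Q := by
  -- For size 3, cof(s · cof Q) = s² det(Q) Q, so s must be a square root of 1 / det Q.
  obtain ⟨s, hs⟩ := IsAlgClosed.exists_pow_nat_eq (Q.det)⁻¹ (n := 2) two_pos
  have h : (s • Q.adjugate.transpose).adjugate.transpose = Q := by
    rw [Matrix.adjugate_smul, ← Matrix.adjugate_transpose, Matrix.transpose_smul,
      Matrix.transpose_transpose, Matrix.adjugate_adjugate _ (by simp)]
    simp [smul_smul, hs, hQ]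
  refine ⟨_, fun h0 => hQ ?_, h⟩
  rw [← h, Matrix.det_transpose, Matrix.det_adjugate, h0]
  simp

/-- If a product of two linear forms lies in the ideal of a linear subspace, so does a factor. -/
theorem mem_span_of_mul_vanish {n : ℕ} {p : Fin n → Module.Dual ℂ V} {l y : Module.Dual ℂ V}
    (hl : l ∉ Submodule.span ℂ (Set.range p)) (h : ∀ w, (∀ i, p i w = 0) → y w * l w = 0) :
    y ∈ Submodule.span ℂ (Set.range p) := by
  obtain ⟨e, he, hle⟩ : ∃ e, (∀ i, p i e = 0) ∧ l e ≠ 0 := by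
    by_contra! hc
    refine hl (mem_span_of_iInf_ker_le_ker fun w hw => hc w ?_)
    simpa [Submodule.mem_iInf] using hw
  have hy := (mul_eq_zero.1 (h e he)).resolve_right hle
  refine mem_span_of_iInf_ker_le_ker fun w hw => ?_
  have hw' : ∀ i, p i w = 0 := by simpa [Submodule.mem_iInf] using hw
  have h1 := h w hw'
  -- Since y(e) = 0, translating by e leaves y(w) l(e) = 0.
  have h2 := h (w + e) (fun i => by simp [hw', he])
  simp only [map_add, hy, add_zero, mul_add, h1, zero_add] at h2
  exact (mul_eq_zero.1 h2).resolve_right hle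

/-! ### Congruence moves on arrow matrices -/

/-- The disjunction of the six formats. -/
def HasSomeFormat (M : LinMatrix V 6 6) : Prop :=
  HasSkewFormat M patternA ∨ HasSkewFormat M patternB ∨ HasSkewFormat M patternC ∨
    HasDoubleSkewFormat M patternD ∨ HasDoubleSkewFormat M patternE ∨
    HasDoubleSkewFormat M patternF

theorem congrBy_mul {r : ℕ} (S T : Matrix (Fin r) (Fin r) ℂ) (M : LinMatrix V r r) :
    congrBy (S * T) M = congrBy S (congrBy T M) := by
  ext i j w
  simp only [congrBy, Matrix.of_apply, LinearMap.sum_apply, LinearMap.smul_apply,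
    smul_eq_mul]
  have h (A : Matrix (Fin r) (Fin r) ℂ) (N : Matrix (Fin r) (Fin r) ℂ) (i j : Fin r) :
      ∑ k, ∑ l, A i k * A j l * N k l = (A * N * A.transpose) i j := by
    simp only [Matrix.mul_apply, Matrix.transpose_apply, Finset.sum_mul]
    rw [Finset.sum_comm]
    exact Finset.sum_congr rfl fun l _ => Finset.sum_congr rfl fun k _ => by ring
  let N : Matrix (Fin r) (Fin r) ℂ := Matrix.of fun k l => M k l w
  have h2 : (Matrix.of fun i j => ∑ k, ∑ l, T i k * T j l * M k l w) = T * N * T.transpose := by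
    ext i j
    exact h T N i j
  calc _ = (S * T * N * (S * T).transpose) i j := h (S * T) N i j
    _ = (S * (T * N * T.transpose) * S.transpose) i j := by
      simp only [Matrix.transpose_mul, Matrix.mul_assoc]
    _ = _ := by rw [← h2, ← h]; rfl

theorem HasSkewFormat.of_congrBy {r : ℕ} {M : LinMatrix V r r} {F : Pattern r r}
    (S : Matrix.GeneralLinearGroup (Fin r) ℂ) (h : HasSkewFormat (congrBy S.val M) F) :
    HasSkewFormat M F := by
  obtain ⟨T, hT⟩ := h
  exact ⟨T * S, by rwa [Units.val_mul, congrBy_mul]⟩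

theorem HasDoubleSkewFormat.of_congrBy {M : LinMatrix V 6 6} {F : Pattern 6 6}
    (S : Matrix.GeneralLinearGroup (Fin 6) ℂ) (h : HasDoubleSkewFormat (congrBy S.val M) F) :
    HasDoubleSkewFormat M F := by
  obtain ⟨T, hT⟩ := h
  exact ⟨T * S, by rwa [Units.val_mul, congrBy_mul]⟩

theorem HasSomeFormat.of_congrBy {M M' : LinMatrix V 6 6} {S S' : Matrix (Fin 6) (Fin 6) ℂ}
    (hS : S * S' = 1) (hM : congrBy S M = M') (h : HasSomeFormat M') : HasSomeFormat M := by
  let T : Matrix.GeneralLinearGroup (Fin 6) ℂ := ⟨S, S', hS, mul_eq_one_comm.1 hS⟩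
  have hT : congrBy T.val M = M' := hM
  rw [← hT] at h
  rcases h with h | h | h | h | h | h
  · exact .inl (h.of_congrBy T)
  · exact .inr (.inl (h.of_congrBy T))
  · exact .inr (.inr (.inl (h.of_congrBy T)))
  · exact .inr (.inr (.inr (.inl (h.of_congrBy T))))
  · exact .inr (.inr (.inr (.inr (.inl (h.of_congrBy T)))))
  · exact .inr (.inr (.inr (.inr (.inr (h.of_congrBy T)))))

/-- The general skew-symmetric matrix of arrow form. -/
def arrow (w : Module.Dual ℂ V) (u v p : Fin 3 → Module.Dual ℂ V) (x y : Module.Dual ℂ V) :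
    LinMatrix V 6 6 :=
  !![0, w, u 0, u 1, u 2, x;
     -w, 0, v 0, v 1, v 2, y;
     -u 0, -v 0, 0, p 2, -p 1, 0;
     -u 1, -v 1, -p 2, 0, p 0, 0;
     -u 2, -v 2, p 1, -p 0, 0, 0;
     -x, -y, 0, 0, 0, 0]

/-- The vector product with a constant vector. -/
def crossConst (p : Fin 3 → Module.Dual ℂ V) (a : Fin 3 → ℂ) : Fin 3 → Module.Dual ℂ V :=
  ![a 2 • p 1 - a 1 • p 2, a 0 • p 2 - a 2 • p 0, a 1 • p 0 - a 0 • p 1]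

theorem congrBy_apply_six (S : Matrix (Fin 6) (Fin 6) ℂ) (M : LinMatrix V 6 6) (i j : Fin 6)
    (w : V) : congrBy S M i j w = ∑ k, ∑ l, S i k * S j l * M k l w := by
  simp [congrBy]

-- Adds combinations of the middle rows to the first two. The corner entry also changes, but no
-- format constrains it, hence the quantifier over `w'`.
set_option maxHeartbeats 1000000 in
theorem HasSomeFormat.of_add_cross {w x y : Module.Dual ℂ V} {u v p : Fin 3 → Module.Dual ℂ V}
    (a b : Fin 3 → ℂ)
    (h : ∀ w', HasSomeFormat (arrow w' (u + crossConst p a) (v + crossConst p b) p x y)) :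
    HasSomeFormat (arrow w u v p x y) := by
  let S (a b : Fin 3 → ℂ) : Matrix (Fin 6) (Fin 6) ℂ :=
    !![1, 0, a 0, a 1, a 2, 0; 0, 1, b 0, b 1, b 2, 0; 0, 0, 1, 0, 0, 0; 0, 0, 0, 1, 0, 0;
      0, 0, 0, 0, 1, 0; 0, 0, 0, 0, 0, 1]
  refine .of_congrBy (S := S a b) (S' := S (-a) (-b)) ?_ ?_ (h (w + ∑ i, b i • u i - ∑ i, a i • v i +
    (a 0 * b 1 - a 1 * b 0) • p 2 + (a 2 * b 0 - a 0 * b 2) • p 1 + (a 1 * b 2 - a 2 * b 1) • p 0))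
  · ext i j
    fin_cases i <;> fin_cases j <;> simp [S, Matrix.mul_apply, Fin.sum_univ_six]
  · ext i j t
    rw [congrBy_apply_six]
    fin_cases i <;> fin_cases j <;>
      simp [S, arrow, crossConst, Fin.sum_univ_six, Fin.sum_univ_three] <;> ring

/-- Adds multiples of the last row to the middle rows; u·p and v·p change by x(e·p) and y(e·p),
while p is unaffected. -/
theorem HasSomeFormat.of_add_smul {w x y : Module.Dual ℂ V} {u v p : Fin 3 → Module.Dual ℂ V}
    (e : Fin 3 → ℂ)
    (h : HasSomeFormat (arrow w (fun i => u i + e i • x) (fun i => v i + e i • y) p x y)) :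
    HasSomeFormat (arrow w u v p x y) := by
  let S (e : Fin 3 → ℂ) : Matrix (Fin 6) (Fin 6) ℂ :=
    !![1, 0, 0, 0, 0, 0; 0, 1, 0, 0, 0, 0; 0, 0, 1, 0, 0, e 0; 0, 0, 0, 1, 0, e 1;
      0, 0, 0, 0, 1, e 2; 0, 0, 0, 0, 0, 1]
  refine .of_congrBy (S := S e) (S' := S (-e)) ?_ ?_ h
  · ext i j
    fin_cases i <;> fin_cases j <;> simp [S, Matrix.mul_apply, Fin.sum_univ_six]
  · ext i j t
    rw [congrBy_apply_six]
    fin_cases i <;> fin_cases j <;> simp [S, arrow, Fin.sum_univ_six] <;> ring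

theorem HasSomeFormat.of_sub_smul {w x y : Module.Dual ℂ V} {u v p : Fin 3 → Module.Dual ℂ V}
    (c : ℂ) (h : HasSomeFormat (arrow w u (fun i => v i + c • u i) p x (y + c • x))) :
    HasSomeFormat (arrow w u v p x y) := by
  let S (c : ℂ) : Matrix (Fin 6) (Fin 6) ℂ :=
    !![1, 0, 0, 0, 0, 0; c, 1, 0, 0, 0, 0; 0, 0, 1, 0, 0, 0; 0, 0, 0, 1, 0, 0;
      0, 0, 0, 0, 1, 0; 0, 0, 0, 0, 0, 1]
  refine .of_congrBy (S := S c) (S' := S (-c)) ?_ ?_ h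
  · ext i j
    fin_cases i <;> fin_cases j <;> simp [S, Matrix.mul_apply, Fin.sum_univ_six]
  · ext i j t
    rw [congrBy_apply_six]
    fin_cases i <;> fin_cases j <;> simp [S, arrow, Fin.sum_univ_six] <;> ring

theorem HasSomeFormat.of_swap {w x y : Module.Dual ℂ V} {u v p : Fin 3 → Module.Dual ℂ V}
    (h : HasSomeFormat (arrow (-w) v u p y x)) :
    HasSomeFormat (arrow w u v p x y) := by
  let S : Matrix (Fin 6) (Fin 6) ℂ :=
    !![0, 1, 0, 0, 0, 0; 1, 0, 0, 0, 0, 0; 0, 0, 1, 0, 0, 0; 0, 0, 0, 1, 0, 0;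
      0, 0, 0, 0, 1, 0; 0, 0, 0, 0, 0, 1]
  refine .of_congrBy (S := S) (S' := S) ?_ ?_ h
  · ext i j
    fin_cases i <;> fin_cases j <;> simp [S, Matrix.mul_apply, Fin.sum_univ_six]
  · ext i j t
    rw [congrBy_apply_six]
    fin_cases i <;> fin_cases j <;> simp [S, arrow, Fin.sum_univ_six]

-- A cross-product matrix [p] satisfies T[p]Tᵗ = [cof(T)p].
set_option maxHeartbeats 1000000 in
theorem HasSomeFormat.of_rowComb {w x y : Module.Dual ℂ V} {u v p : Fin 3 → Module.Dual ℂ V}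
    (T : Matrix (Fin 3) (Fin 3) ℂ) (hT : T.det ≠ 0)
    (h : HasSomeFormat
      (arrow w (rowComb T u) (rowComb T v) (rowComb T.adjugate.transpose p) x y)) :
    HasSomeFormat (arrow w u v p x y) := by
  let S (T : Matrix (Fin 3) (Fin 3) ℂ) : Matrix (Fin 6) (Fin 6) ℂ :=
    !![1, 0, 0, 0, 0, 0; 0, 1, 0, 0, 0, 0; 0, 0, T 0 0, T 0 1, T 0 2, 0;
      0, 0, T 1 0, T 1 1, T 1 2, 0; 0, 0, T 2 0, T 2 1, T 2 2, 0; 0, 0, 0, 0, 0, 1]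
  have hT' (i j : Fin 3) := congrFun (congrFun (Matrix.mul_nonsing_inv T hT.isUnit) i) j
  simp only [Matrix.mul_apply, Fin.sum_univ_three] at hT'
  refine .of_congrBy (S := S T) (S' := S T⁻¹) ?_ ?_ h
  · ext i j
    fin_cases i <;> fin_cases j <;> simp [S, Matrix.mul_apply, Fin.sum_univ_six, hT']
  · ext i j t
    rw [congrBy_apply_six]
    fin_cases i <;> fin_cases j <;> simp [S, arrow, Fin.sum_univ_six, rowComb,
      Fin.sum_univ_three, Matrix.adjugate_fin_three] <;> ring

theorem congrBy_perm (σ : Equiv.Perm (Fin 6)) (M : LinMatrix V 6 6) :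
    congrBy (Matrix.of fun i k => if σ i = k then 1 else 0) M = M.submatrix σ σ := by
  ext i j w
  rw [congrBy_apply_six, Finset.sum_eq_single (σ i), Finset.sum_eq_single (σ j)] <;>
    simp +contextual [eq_comm]

theorem perm_mul (σ : Equiv.Perm (Fin 6)) :
    (Matrix.of fun i k => if σ i = k then (1 : ℂ) else 0) *
      (Matrix.of fun i k => if σ.symm i = k then (1 : ℂ) else 0) = 1 := by
  ext i j
  rw [Matrix.mul_apply, Finset.sum_eq_single (σ i)] <;>
    simp +contextual [Matrix.one_apply, eq_comm]

theorem HasSkewFormat.of_perm {M : LinMatrix V 6 6} {F : Pattern 6 6} (σ : Equiv.Perm (Fin 6))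
    (h : HasForm (M.submatrix σ σ) F) : HasSkewFormat M F := by
  refine ⟨⟨Matrix.of fun i k => if σ i = k then 1 else 0,
    Matrix.of fun i k => if σ.symm i = k then 1 else 0, perm_mul σ, perm_mul σ.symm⟩, ?_⟩
  rwa [congrBy_perm]

theorem pfaffian_eval_eq_zero {M : LinMatrix V 6 6} (h : pf M = 0) (t : V) :
    Matrix.pfaffian 6 (Matrix.of fun i j => M i j t) = 0 := by
  have h1 := congrArg (SymmetricAlgebra.lift (Module.Dual.eval ℂ V t)).toRingHom h
  rw [pf, map_pfaffian, map_zero] at h1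
  convert h1 using 2
  ext i j
  simp

/-- This is Tᵗ cof(T) = det(T) · 1: base changes of the middle block preserve the dot products up to
a scalar. -/
theorem rowComb_dot (T : Matrix (Fin 3) (Fin 3) ℂ) (v p : Fin 3 → Module.Dual ℂ V) (t : V) :
    ∑ i, rowComb T v i t * rowComb T.adjugate.transpose p i t = T.det * ∑ i, v i t * p i t := by
  simp [rowComb, Fin.sum_univ_three, Matrix.adjugate_fin_three, Matrix.det_fin_three]
  ring

theorem eq_arrow {M : LinMatrix V 6 6} (hM : IsSkew M) (h : HasForm M arrowPattern) :
    M = arrow (M 0 1) ![M 0 2, M 0 3, M 0 4] ![M 1 2, M 1 3, M 1 4] ![M 3 4, -M 2 4, M 2 3]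
      (M 0 5) (M 1 5) := by
  conv_lhs => rw [eq_skewSix hM]
  rw [h 2 5 rfl, h 3 5 rfl, h 4 5 rfl]
  ext1 i j
  fin_cases i <;> fin_cases j <;> simp [skewSix, arrow]

/-! ### Reading the six formats off an arrow matrix -/

section formats

variable {w x y l : Module.Dual ℂ V} {u v p : Fin 3 → Module.Dual ℂ V}

theorem arrow_patternA_of_last (hx : x = 0) (hy : y = 0) :
    HasSkewFormat (arrow w u v p x y) patternA := by
  refine .of_perm 1 fun i j => ?_
  fin_cases i <;> fin_cases j <;> simp [arrow, patternA, *]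

theorem arrow_patternA (hu : u 0 = 0) (hv : v 0 = 0) (hp1 : p 1 = 0) (hp2 : p 2 = 0) :
    HasSkewFormat (arrow w u v p x y) patternA := by
  refine .of_perm ⟨![0, 1, 5, 3, 4, 2], ![0, 1, 5, 3, 4, 2], by decide, by decide⟩ fun i j => ?_
  fin_cases i <;> fin_cases j <;> simp [arrow, patternA, *]

theorem arrow_patternB (hp : p = 0) :
    HasSkewFormat (arrow w u v p x y) patternB := by
  refine .of_perm 1 fun i j => ?_
  fin_cases i <;> fin_cases j <;> simp [arrow, patternB, *]

theorem arrow_patternB_of_right (hv0 : v 0 = 0) (hv1 : v 1 = 0) (hp2 : p 2 = 0) (hy : y = 0) :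
    HasSkewFormat (arrow w u v p x y) patternB := by
  refine .of_perm ⟨![0, 4, 1, 2, 3, 5], ![0, 2, 3, 4, 1, 5], by decide, by decide⟩ fun i j => ?_
  fin_cases i <;> fin_cases j <;> simp [arrow, patternB, *]

theorem arrow_patternC (hu0 : u 0 = 0) (hu1 : u 1 = 0) (hv0 : v 0 = 0) (hv1 : v 1 = 0)
    (hp2 : p 2 = 0) : HasSkewFormat (arrow w u v p x y) patternC := by
  refine .of_perm ⟨![4, 0, 1, 5, 2, 3], ![1, 2, 4, 5, 0, 3], by decide, by decide⟩ fun i j => ?_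
  fin_cases i <;> fin_cases j <;> simp [arrow, patternC, *]

theorem arrow_patternC_of_middle (hv0 : v 0 = 0) (hp1 : p 1 = 0) (hp2 : p 2 = 0) (hy : y = 0) :
    HasSkewFormat (arrow w u v p x y) patternC := by
  refine .of_perm ⟨![0, 1, 3, 4, 2, 5], ![0, 1, 4, 2, 3, 5], by decide, by decide⟩ fun i j => ?_
  fin_cases i <;> fin_cases j <;> simp [arrow, patternC, *]

theorem arrow_patternC_of_right (hv : v = 0) (hy : y = 0) :
    HasSkewFormat (arrow w u v p x y) patternC := by
  refine .of_perm ⟨![0, 2, 3, 4, 1, 5], ![0, 4, 1, 2, 3, 5], by decide, by decide⟩ fun i j => ?_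
  fin_cases i <;> fin_cases j <;> simp [arrow, patternC, *]

/-- The skew-symmetric `3 × 3` matrix with prescribed entries above the diagonal. -/
def skewThree (a b c : Module.Dual ℂ V) : LinMatrix V 3 3 :=
  !![0, a, b; -a, 0, c; -b, -c, 0]

theorem isSkew_skewThree (a b c : Module.Dual ℂ V) : IsSkew (skewThree a b c) := by
  unfold IsSkew
  ext i j
  fin_cases i <;> fin_cases j <;> simp [skewThree]

theorem fromBlocks_skewThree (a b c d e f g h i : Module.Dual ℂ V) :
    (Matrix.fromBlocks (skewThree a b c) (skewThree d e f) (-(skewThree d e f).transpose)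
      (skewThree g h i)).submatrix
        (finSumFinEquiv (m := 3) (n := 3)).symm (finSumFinEquiv (m := 3) (n := 3)).symm =
      !![0, a, b, 0, d, e; -a, 0, c, -d, 0, f; -b, -c, 0, -e, -f, 0;
        0, d, e, 0, g, h; -d, 0, f, -g, 0, i; -e, -f, 0, -h, -i, 0] := by
  ext1 i j
  fin_cases i <;> fin_cases j <;>
    simp [skewThree, finSumFinEquiv, Fin.addCases, Fin.castLT, Fin.subNat]

theorem HasDoubleSkewFormat.of_congrBy_eq {M : LinMatrix V 6 6} {F : Pattern 6 6}
    {S S' : Matrix (Fin 6) (Fin 6) ℂ} (a b c d e f g h i : Module.Dual ℂ V) (hS : S * S' = 1)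
    (hM : congrBy S M = !![0, a, b, 0, d, e; -a, 0, c, -d, 0, f; -b, -c, 0, -e, -f, 0;
        0, d, e, 0, g, h; -d, 0, f, -g, 0, i; -e, -f, 0, -h, -i, 0])
    (hF : HasForm (congrBy S M) F) : HasDoubleSkewFormat M F :=
  ⟨⟨S, S', hS, mul_eq_one_comm.1 hS⟩,
    ⟨_, _, _, isSkew_skewThree a b c, isSkew_skewThree d e f, isSkew_skewThree g h i,
      hM.trans (fromBlocks_skewThree a b c d e f g h i).symm⟩, hF⟩

theorem arrow_patternD (hu : u = 0) (hv : v = 0) :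
    HasDoubleSkewFormat (arrow w u v p x y) patternD := by
  let σ : Equiv.Perm (Fin 6) := ⟨![0, 1, 5, 2, 3, 4], ![0, 1, 3, 4, 5, 2], by decide, by decide⟩
  refine .of_congrBy_eq w x y 0 0 0 (p 2) (-p 1) (p 0) (perm_mul σ) ?_ ?_ <;> rw [congrBy_perm]
  · ext1 i j
    fin_cases i <;> fin_cases j <;> simp [arrow, σ, hu, hv]
  · intro i j
    fin_cases i <;> fin_cases j <;> simp [arrow, patternD, σ, hu, hv]

/-- Reversing the middle indices and negating one makes the off-diagonal block skew. The diagonal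
blocks then carry w, u₂, v₂ and p₂, whose vanishing separates (e) from (f). -/
theorem arrow_congrBy_signed (hu0 : u 0 = l) (hu1 : u 1 = 0) (hv0 : v 0 = 0) (hv1 : v 1 = l)
    (hp0 : p 0 = x) (hp1 : p 1 = y) :
    congrBy !![1, 0, 0, 0, 0, 0; 0, 1, 0, 0, 0, 0; 0, 0, 0, 0, 1, 0;
      0, 0, 0, 1, 0, 0; 0, 0, -1, 0, 0, 0; 0, 0, 0, 0, 0, 1] (arrow w u v p x y) =
      !![0, w, u 2, 0, -l, x; -w, 0, v 2, -(-l), 0, y; -u 2, -v 2, 0, -x, -y, 0;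
        0, -l, x, 0, p 2, 0; -(-l), 0, y, -p 2, 0, 0; -x, -y, 0, -0, -0, 0] := by
  ext i j t
  rw [congrBy_apply_six]
  fin_cases i <;> fin_cases j <;> simp [arrow, Fin.sum_univ_six, *]

theorem signed_mul : (!![1, 0, 0, 0, 0, 0; 0, 1, 0, 0, 0, 0; 0, 0, 0, 0, 1, 0;
      0, 0, 0, 1, 0, 0; 0, 0, -1, 0, 0, 0; 0, 0, 0, 0, 0, 1] : Matrix (Fin 6) (Fin 6) ℂ) *
    !![1, 0, 0, 0, 0, 0; 0, 1, 0, 0, 0, 0; 0, 0, 0, 0, -1, 0;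
      0, 0, 0, 1, 0, 0; 0, 0, 1, 0, 0, 0; 0, 0, 0, 0, 0, 1] = 1 := by
  ext i j
  fin_cases i <;> fin_cases j <;> simp [Matrix.mul_apply, Fin.sum_univ_six]

theorem arrow_patternE (hu0 : u 0 = l) (hu1 : u 1 = 0) (hv0 : v 0 = 0) (hv1 : v 1 = l)
    (hp0 : p 0 = x) (hp1 : p 1 = y) (hp2 : p 2 = 0) :
    HasDoubleSkewFormat (arrow w u v p x y) patternE := by
  have h := arrow_congrBy_signed (w := w) hu0 hu1 hv0 hv1 hp0 hp1
  refine .of_congrBy_eq _ _ _ _ _ _ _ _ _ signed_mul h ?_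
  rw [h, hp2]
  intro i j
  fin_cases i <;> fin_cases j <;> simp [patternE]

theorem arrow_patternF (hu0 : u 0 = l) (hu1 : u 1 = 0) (hv0 : v 0 = 0) (hv1 : v 1 = l)
    (hp0 : p 0 = x) (hp1 : p 1 = y) (hu2 : u 2 = 0) (hv2 : v 2 = 0) :
    HasDoubleSkewFormat (arrow w u v p x y) patternF := by
  have h := arrow_congrBy_signed (w := w) hu0 hu1 hv0 hv1 hp0 hp1
  refine .of_congrBy_eq _ _ _ _ _ _ _ _ _ signed_mul h ?_
  rw [h, hu2, hv2]
  intro i j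
  fin_cases i <;> fin_cases j <;> simp [patternF]

end formats

/-! ### Koszul normalization and the case analysis -/

variable [FiniteDimensional ℂ V]

theorem syzygy_one {a v : Module.Dual ℂ V} (ha : a ≠ 0) (h : ∀ t, v t * a t = 0) : v = 0 := by
  obtain ⟨A, hA, hv⟩ := koszul_syzygy (p := ![a]) (v := ![v])
    (by simpa [linearIndependent_unique_iff] using ha) (by simpa using h)
  have h0 := skew_diag (N := Matrix.of A) (by ext i j; exact hA j i) 0
  have hv0 := hv 0
  simp only [Matrix.of_apply] at h0
  simpa [h0] using hv0

theorem syzygy_two {a b v₀ v₁ : Module.Dual ℂ V} (hab : LinearIndependent ℂ ![a, b])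
    (h : ∀ t, v₀ t * a t + v₁ t * b t = 0) : ∃ c : ℂ, v₀ = c • b ∧ v₁ = -(c • a) := by
  obtain ⟨A, hA, hv⟩ := koszul_syzygy (p := ![a, b]) (v := ![v₀, v₁]) hab
    (by simpa [Fin.sum_univ_two] using h)
  have h0 (i : Fin 2) : A i i = 0 := skew_diag (N := Matrix.of A) (by ext i j; exact hA j i) i
  refine ⟨A 0 1, by simpa [h0] using hv 0, ?_⟩
  have hv1 := hv 1
  rw [Fin.sum_univ_two, hA 1 0] at hv1
  simpa [h0] using hv1

theorem syzygy_three {p v : Fin 3 → Module.Dual ℂ V} (hp : LinearIndependent ℂ p)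
    (h : ∀ t, ∑ i, v i t * p i t = 0) : ∃ c : Fin 3 → ℂ, v + crossConst p c = 0 := by
  obtain ⟨A, hA, hv⟩ := koszul_syzygy hp h
  have h0 (i : Fin 3) : A i i = 0 := skew_diag (N := Matrix.of A) (by ext i j; exact hA j i) i
  refine ⟨![-A 1 2, A 0 2, -A 0 1], ?_⟩
  ext1 i
  rw [Pi.add_apply, hv i, Fin.sum_univ_three]
  fin_cases i <;> simp [crossConst, h0, hA 1 0, hA 2 0, hA 2 1]
  all_goals abel

section

variable {w x y l : Module.Dual ℂ V} {u v p : Fin 3 → Module.Dual ℂ V}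

theorem arrow_format_of_reduced (hp : IsReduced p) (hu : ∀ t, ∑ i, u i t * p i t = 0)
    (hv : ∀ t, ∑ i, v i t * p i t = 0) : HasSomeFormat (arrow w u v p x y) := by
  simp only [Fin.sum_univ_three] at hu hv
  rcases hp with rfl | ⟨a, ha, rfl⟩ | ⟨a, b, hab, rfl⟩ | hp
  · exact .inr (.inl (arrow_patternB (by ext i; fin_cases i <;> rfl)))
  · exact .inl (arrow_patternA (syzygy_one ha (by simpa using hu))
      (syzygy_one ha (by simpa using hv)) rfl rfl)
  · obtain ⟨c, hc0, hc1⟩ := syzygy_two hab (by simpa using hu)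
    obtain ⟨d, hd0, hd1⟩ := syzygy_two hab (by simpa using hv)
    -- With p₂ = 0, the third middle row alone cancels the Koszul part of the first two entries.
    exact .of_add_cross ![0, 0, -c] ![0, 0, -d] fun w' => .inr (.inr (.inl (arrow_patternC
      (by simp [crossConst, hc0]) (by simp [crossConst, hc1])
      (by simp [crossConst, hd0]) (by simp [crossConst, hd1]) rfl)))
  · obtain ⟨c, hc⟩ := syzygy_three hp (by simpa [Fin.sum_univ_three] using hu)
    obtain ⟨d, hd⟩ := syzygy_three hp (by simpa [Fin.sum_univ_three] using hv)
    exact .of_add_cross c d fun w' => .inr (.inr (.inr (.inl (arrow_patternD hc hd))))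

theorem arrow_format_of_reduced_right (hp : IsReduced p)
    (hv : ∀ t, ∑ i, v i t * p i t = 0) : HasSomeFormat (arrow w u v p x 0) := by
  simp only [Fin.sum_univ_three] at hv
  rcases hp with rfl | ⟨a, ha, rfl⟩ | ⟨a, b, hab, rfl⟩ | hp
  · exact .inr (.inl (arrow_patternB (by ext i; fin_cases i <;> rfl)))
  · exact .inr (.inr (.inl (arrow_patternC_of_middle (syzygy_one ha (by simpa using hv))
      rfl rfl rfl)))
  · obtain ⟨d, hd0, hd1⟩ := syzygy_two hab (by simpa using hv)
    exact .of_add_cross 0 ![0, 0, -d] fun w' => .inr (.inl (arrow_patternB_of_right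
      (by simp [crossConst, hd0]) (by simp [crossConst, hd1]) rfl rfl))
  · obtain ⟨d, hd⟩ := syzygy_three hp (by simpa [Fin.sum_univ_three] using hv)
    exact .of_add_cross 0 d fun w' => .inr (.inr (.inl (arrow_patternC_of_right hd rfl)))

theorem arrow_format_of_dot_eq_zero (hu : ∀ t, ∑ i, u i t * p i t = 0)
    (hv : ∀ t, ∑ i, v i t * p i t = 0) : HasSomeFormat (arrow w u v p x y) := by
  obtain ⟨Q, hQ, hQp⟩ := exists_isReduced_rowComb p
  obtain ⟨T, hT, rfl⟩ := exists_cofactor_eq Q hQ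
  exact .of_rowComb T hT (arrow_format_of_reduced hQp
    (fun t => by rw [rowComb_dot, hu, mul_zero]) (fun t => by rw [rowComb_dot, hv, mul_zero]))

theorem arrow_format_of_right (hv : ∀ t, ∑ i, v i t * p i t = 0) :
    HasSomeFormat (arrow w u v p x 0) := by
  obtain ⟨Q, hQ, hQp⟩ := exists_isReduced_rowComb p
  obtain ⟨T, hT, rfl⟩ := exists_cofactor_eq Q hQ
  exact .of_rowComb T hT (arrow_format_of_reduced_right hQp
    (fun t => by rw [rowComb_dot, hv, mul_zero]))

theorem arrow_format_of_dependent {c : ℂ} (hc : y + c • x = 0)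
    (h : ∀ t, x t * ∑ i, v i t * p i t = y t * ∑ i, u i t * p i t) :
    HasSomeFormat (arrow w u v p x y) := by
  refine .of_sub_smul c ?_
  rw [hc]
  by_cases hx : x = 0
  · exact .inl (arrow_patternA_of_last hx rfl)
  refine arrow_format_of_right fun t => ?_
  rw [← tensorSum_apply (fun i => v i + c • u i) p t t]
  refine mul_vanish hx _ (fun t => ?_) t
  have hct : y t + c * x t = 0 := by simpa using LinearMap.congr_fun hc t
  have := h t
  rw [tensorSum_apply]
  simp only [Fin.sum_univ_three, LinearMap.add_apply, LinearMap.smul_apply, smul_eq_mul] at this ⊢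
  linear_combination this + (u 0 t * p 0 t + u 1 t * p 1 t + u 2 t * p 2 t) * hct

theorem arrow_format_of_notMem_span (hxy : LinearIndependent ℂ ![x, y])
    (hl : l ∉ Submodule.span ℂ (Set.range p)) (hu : ∀ t, ∑ i, u i t * p i t = x t * l t)
    (hv : ∀ t, ∑ i, v i t * p i t = y t * l t) : HasSomeFormat (arrow w u v p x y) := by
  have hx : x ∈ Submodule.span ℂ (Set.range p) :=
    mem_span_of_mul_vanish hl fun t ht => by simp [← hu, ht]
  have hy : y ∈ Submodule.span ℂ (Set.range p) :=
    mem_span_of_mul_vanish hl fun t ht => by simp [← hv, ht]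
  obtain ⟨Q, hQ, z, hz, hxyz⟩ := exists_rowComb_eq hxy hx hy
  obtain ⟨T, hT, rfl⟩ := exists_cofactor_eq Q hQ
  refine .of_rowComb T hT ?_
  -- The determinant factor is absorbed by using det(T) · l as the new l.
  have hu' (t : V) := (rowComb_dot T u p t).trans (by rw [hu])
  have hv' (t : V) := (rowComb_dot T v p t).trans (by rw [hv])
  rw [hz] at hu' hv' ⊢
  generalize rowComb T u = u' at hu' ⊢
  generalize rowComb T v = v' at hv' ⊢
  simp only [Fin.sum_univ_three, Matrix.cons_val] at hu' hv'
  rcases hxyz with rfl | hxyz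
  · obtain ⟨c, hc0, hc1⟩ := syzygy_two (v₀ := u' 0 - T.det • l) (v₁ := u' 1) hxy (fun t => by
      have := hu' t
      simp only [LinearMap.zero_apply, LinearMap.sub_apply, LinearMap.smul_apply,
        smul_eq_mul] at this ⊢
      linear_combination this)
    obtain ⟨d, hd0, hd1⟩ := syzygy_two (v₀ := v' 0) (v₁ := v' 1 - T.det • l) hxy (fun t => by
      have := hv' t
      simp only [LinearMap.zero_apply, LinearMap.sub_apply, LinearMap.smul_apply,
        smul_eq_mul] at this ⊢
      linear_combination this)
    rw [sub_eq_iff_eq_add] at hc0 hd1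
    exact .of_add_cross ![0, 0, -c] ![0, 0, -d] fun w' => .inr (.inr (.inr (.inr (.inl
      (arrow_patternE (l := T.det • l) (by simp [crossConst, hc0]) (by simp [crossConst, hc1])
        (by simp [crossConst, hd0]) (by simp [crossConst, hd1]) rfl rfl rfl)))))
  -- Since p starts with x, y, the triples (l, 0, 0) and (0, l, 0) are particular solutions; the
  -- differences are syzygies.
  · obtain ⟨c, hc⟩ := syzygy_three (v := u' - ![T.det • l, 0, 0]) hxyz (fun t => by
      have := hu' t
      simp [Fin.sum_univ_three]
      linear_combination this)
    obtain ⟨d, hd⟩ := syzygy_three (v := v' - ![0, T.det • l, 0]) hxyz (fun t => by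
      have := hv' t
      simp [Fin.sum_univ_three]
      linear_combination this)
    have hc' : u' + crossConst ![x, y, z] c = ![T.det • l, 0, 0] := by
      rw [← sub_eq_zero, ← hc]; abel
    have hd' : v' + crossConst ![x, y, z] d = ![0, T.det • l, 0] := by
      rw [← sub_eq_zero, ← hd]; abel
    refine .of_add_cross c d fun w' => .inr (.inr (.inr (.inr (.inr ?_))))
    rw [hc', hd']
    exact arrow_patternF rfl rfl rfl rfl rfl rfl rfl rfl

theorem arrow_format (h : ∀ t, x t * ∑ i, v i t * p i t = y t * ∑ i, u i t * p i t) :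
    HasSomeFormat (arrow w u v p x y) := by
  by_cases hxy : LinearIndependent ℂ ![x, y]
  · obtain ⟨l, hl⟩ := exists_common_factor (tensorSum v p) (tensorSum u p) hxy
      (fun t => by simpa only [tensorSum_apply] using h t)
    simp only [tensorSum_apply] at hl
    by_cases hlp : l ∈ Submodule.span ℂ (Set.range p)
    · obtain ⟨e, he⟩ := (Submodule.mem_span_range_iff_exists_fun ℂ).1 hlp
      have he' (t : V) : l t = ∑ i, e i * p i t := by simp [← he]
      refine .of_add_smul (-e) (arrow_format_of_dot_eq_zero (fun t => ?_) fun t => ?_)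
      · have h2 := (hl t).2
        rw [he'] at h2
        simp only [Fin.sum_univ_three, LinearMap.add_apply, LinearMap.smul_apply, smul_eq_mul,
          Pi.neg_apply] at h2 ⊢
        linear_combination h2
      · have h2 := (hl t).1
        rw [he'] at h2
        simp only [Fin.sum_univ_three, LinearMap.add_apply, LinearMap.smul_apply, smul_eq_mul,
          Pi.neg_apply] at h2 ⊢
        linear_combination h2
    · exact arrow_format_of_notMem_span hxy hlp (fun t => (hl t).2) (fun t => (hl t).1)
  obtain ⟨g, hg, i, hi⟩ := Fintype.not_linearIndependent_iff.1 hxy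
  simp only [Fin.sum_univ_two, Matrix.cons_val_zero, Matrix.cons_val_one] at hg
  fin_cases i
  · refine .of_swap (arrow_format_of_dependent (c := (g 0)⁻¹ * g 1) ?_ fun t => (h t).symm)
    have := congrArg ((g 0)⁻¹ • ·) hg
    simpa [smul_smul, inv_mul_cancel₀ (show g 0 ≠ 0 from hi)] using this
  · refine arrow_format_of_dependent (c := (g 1)⁻¹ * g 0) ?_ h
    have := congrArg ((g 1)⁻¹ • ·) hg
    simpa [smul_smul, inv_mul_cancel₀ (show g 1 ≠ 0 from hi), add_comm] using this

end

theorem hasSomeFormat_of_arrow {M : LinMatrix V 6 6} (hskew : IsSkew M)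
    (harrow : HasSkewFormat M arrowPattern) (hpf : pf M = 0) : HasSomeFormat M := by
  obtain ⟨S, hS⟩ := harrow
  have hN (t : V) : (Matrix.of fun i j => congrBy S.val M i j t) =
      S.val * (Matrix.of fun i j => M i j t) * S.val.transpose := by
    ext i j
    simp only [Matrix.of_apply, congrBy_apply_six, Matrix.mul_apply, Matrix.transpose_apply,
      Finset.sum_mul]
    rw [Finset.sum_comm]
    exact Finset.sum_congr rfl fun l _ => Finset.sum_congr rfl fun k _ => by ring
  have hskew' (t : V) : (Matrix.of fun i j => M i j t).transpose =
      -(Matrix.of fun i j => M i j t) := by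
    ext i j
    simp [skew_entries hskew i j]
  have hskewS : IsSkew (congrBy S.val M) := by
    unfold IsSkew
    ext i j t
    simp only [Matrix.transpose_apply, Matrix.neg_apply, LinearMap.neg_apply, congrBy_apply_six]
    rw [Finset.sum_comm]
    simp only [← Finset.sum_neg_distrib]
    refine Finset.sum_congr rfl fun l _ => Finset.sum_congr rfl fun k _ => ?_
    rw [skew_entries hskew l k, LinearMap.neg_apply]
    ring
  -- Congruence invariance is applied after evaluation at t, where the matrices are scalar.
  have hpfS (t : V) : Matrix.pfaffian 6 (Matrix.of fun i j => congrBy S.val M i j t) = 0 := by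
    rw [hN]
    exact pfaffian_congr_eq_zero _ ((Matrix.isUnit_iff_isUnit_det _).1 S.isUnit).ne_zero _
      (hskew' t) (pfaffian_eval_eq_zero hpf t)
  refine .of_congrBy (S := S.val) (S' := S.inv) S.val_inv rfl ?_
  generalize congrBy S.val M = N at hS hskewS hpfS
  rw [eq_arrow hskewS hS]
  refine arrow_format fun t => ?_
  have := hpfS t
  rw [pfaffian_six] at this
  simp only [Matrix.of_apply, hS 2 5 rfl, hS 3 5 rfl, hS 4 5 rfl, LinearMap.zero_apply] at this
  simp [Fin.sum_univ_three]
  linear_combination this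

end LinForms

theorem mainTheorem2 {V : Type*} [AddCommGroup V] [Module ℂ V] [FiniteDimensional ℂ V]
    (M : LinForms.LinMatrix V 6 6) (hskew : LinForms.IsSkew M)
    (harrow : LinForms.HasSkewFormat M LinForms.arrowPattern)
    (hpf : LinForms.pf M = 0) :
    LinForms.HasSkewFormat M LinForms.patternA ∨
    LinForms.HasSkewFormat M LinForms.patternB ∨
    LinForms.HasSkewFormat M LinForms.patternC ∨
    LinForms.HasDoubleSkewFormat M LinForms.patternD ∨
    LinForms.HasDoubleSkewFormat M LinForms.patternE ∨
    LinForms.HasDoubleSkewFormat M LinForms.patternF :=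
  LinForms.hasSomeFormat_of_arrow hskew harrow hpf
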